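/- Let $\mathcal P\subset\mathbb R^d$ be a nonempty lattice polytope, i.e. the convex hull of a nonempty finite subset of $\mathbb Z^d$ (not necessarily of full dimension). Let $\kappa$ be a positive integer such that $Q=\kappa\mathcal P$ is normal, meaning that for every integer $k\ge 1$ each lattice point of $kQ$ is a sum of exactly $k$ lattice points of $Q$. Put $A=Q\cap\mathbb Z^d=\{\mathbf m_1,\dots,\mathbf m_s\}$, let $\Phi:(\mathbb C^*)^d\to\mathbb{CP}^{s-1}$ be $\Phi(\mathbf z)=[\mathbf z^{\mathbf m_1}:\dots:\mathbf z^{\mathbf m_s}]$, and let $X_A$ be the closure of the image of $\Phi$. For a nonempty face $F$ of $Q$ (possibly $F=Q$), let $X^0(F)$ be the set of points of $X_A$ whose nonzero coordinates are exactly those indexed by the lattice points in $F$; the sets $X^0(F)$ partition $X_A$. For a Laurent polynomial $H=\sum_{\mathbf m}c_{\mathbf m}\mathbf z^{\mathbf m}$ with complex coefficients, its Newton polytope is the convex hull of the $\mathbf m$ with $c_{\mathbf m}\neq 0$; further put $V^*=\{\mathbf z\in(\mathbb C^*)^d: H(\mathbf z)=0\}$ and $\nabla_{\log}H=\left(z_1\frac{\partial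 H}{\partial z_1},\dots,z_d\frac{\partial H}{\partial z_d}\right)$. Consider the set of all coefficient vectors $(c_{\mathbf m})_{\mathbf m\in\mathcal P\cap\mathbb Z^d}$ of Laurent polynomials $H$ with Newton polytope $\mathcal P$ for which there exist a nonempty face $F$ of $Q$, a point $p\in X^0(F)$, a vertex $\mathfrak v$ of the corresponding face $\mathcal F=\kappa^{-1}F$ of $\mathcal P$, and a sequence $(\mathbf z_n)_{n\ge 1}$ in $V^*$ such that $\Phi(\mathbf z_n)\to p$ and $\mathbf z_n^{-\mathfrak v}\,\nabla_{\log}H(\mathbf z_n)\to\mathbf 0$. Then this set has positive codimension in $\mathbb C^{\mathcal P\cap\mathbb Z^d}$: its Zariski closure has positive codimension (the empty set being assigned codimension $+\infty$), i.e. some nonzero polynomial in the coefficients vanishes on it. In other words, for all $H$ with Newton polytope $\mathcal P$ and coefficient vector outside a set of positive codimension, $\mathbf z^{-\mathfrak v}\nabla_{\log}H$ does not tend to the zero vector along any sequence in $V^*$ whose image under $\Phi$ converges to a point of $X_A$, in particular to a point at infinity $p\in X_A\setminus\Phi((\mathbb C^*)^d)$. -/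

import Mathlib

open Filter Topology
open scoped Pointwise LinearAlgebra.Projectivization

noncomputable section

/-! ### Lattice polytopes -/

/-- The inclusion `ℤ^d ⊆ ℝ^d`. -/
def latticeVec {d : ℕ} (m : Fin d → ℤ) : Fin d → ℝ := fun i => (m i : ℝ)

/-- `P` is a (nonempty) lattice polytope: the convex hull of a nonempty finite set of integer
points. It need not have full dimension. -/
def IsLatticePolytope {d : ℕ} (P : Set (Fin d → ℝ)) : Prop :=
  ∃ S : Finset (Fin d → ℤ), S.Nonempty ∧ P = convexHull ℝ (latticeVec '' (S : Set (Fin d → ℤ)))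

/-- The lattice points `P ∩ ℤ^d` of a set `P ⊆ ℝ^d`. -/
def latticePoints {d : ℕ} (P : Set (Fin d → ℝ)) : Set (Fin d → ℤ) := {m | latticeVec m ∈ P}

/-- A lattice polytope `Q` is normal if, for every positive integer `k`, every lattice point of
`kQ` is a sum of exactly `k` lattice points of `Q`. -/
def IsNormalPolytope {d : ℕ} (Q : Set (Fin d → ℝ)) : Prop :=
  IsLatticePolytope Q ∧ ∀ k : ℕ, 0 < k → ∀ x ∈ latticePoints ((k : ℝ) • Q),
    ∃ w : Fin k → (Fin d → ℤ), (∀ i, w i ∈ latticePoints Q) ∧ ∑ i, w i = x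

/-- The (nonempty) faces of a polytope `Q`: the subsets on which some linear functional attains
its maximum over `Q`. The polytope `Q` is a face of itself. -/
def IsPolytopeFace {d : ℕ} (Q F : Set (Fin d → ℝ)) : Prop :=
  F.Nonempty ∧ IsExposed ℝ Q F

theorem IsLatticePolytope.latticePoints_smul_nonempty {d : ℕ} {P : Set (Fin d → ℝ)}
    (hP : IsLatticePolytope P) (κ : ℕ) : (latticePoints ((κ : ℝ) • P)).Nonempty := by
  obtain ⟨S, ⟨v, hv⟩, rfl⟩ := hP
  refine ⟨fun i => (κ : ℤ) * v i, latticeVec v, subset_convexHull ℝ _ ⟨v, hv, rfl⟩, ?_⟩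
  funext i
  simp [latticeVec]

/-! ### Laurent polynomials -/

/-- The algebraic torus `(ℂ^*)^d`. -/
abbrev AlgTorus (d : ℕ) : Type := {z : Fin d → ℂ // ∀ i, z i ≠ 0}

/-- The Laurent monomial `z^m`. -/
def laurentMonomial {d : ℕ} (m : Fin d → ℤ) (z : Fin d → ℂ) : ℂ := ∏ i, z i ^ m i

/-- Laurent polynomials in `d` variables with complex coefficients: the group algebra of `ℤ^d`. -/
abbrev MvLaurent (d : ℕ) : Type := AddMonoidAlgebra ℂ (Fin d → ℤ)

/-- The value of a Laurent polynomial at a point (meaningful on the torus). -/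
def MvLaurent.value {d : ℕ} (H : MvLaurent d) (z : Fin d → ℂ) : ℂ :=
  H.coeff.sum fun m a => a * laurentMonomial m z

/-- The Newton polytope: the convex hull of the exponents with nonzero coefficient. -/
def newtonPolytope {d : ℕ} (H : MvLaurent d) : Set (Fin d → ℝ) :=
  convexHull ℝ (latticeVec '' (H.coeff.support : Set (Fin d → ℤ)))

/-- The vector of the coefficients of `H` at the lattice points of `P`. -/
def coeffVector {d : ℕ} (P : Set (Fin d → ℝ)) (H : MvLaurent d) : latticePoints P → ℂ :=
  fun m => H.coeff m

/-- `V^*`, the zero set of `H` in the torus. -/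
def torusZeroSet {d : ℕ} (H : MvLaurent d) : Set (AlgTorus d) := {z | H.value z = 0}

/-- The log-gradient `(z₁ ∂H/∂z₁, …, z_d ∂H/∂z_d)`. -/
def logGradient {d : ℕ} (H : MvLaurent d) (z : Fin d → ℂ) : Fin d → ℂ :=
  fun i => z i * deriv (fun t => H.value (Function.update z i t)) (z i)

/-! ### The toric compactification -/

/-- The usual (quotient) topology of a complex projective space. -/
instance complexProjectiveTopology {ι : Type*} : TopologicalSpace (ℙ ℂ (ι → ℂ)) :=
  TopologicalSpace.coinduced (Projectivization.mk' ℂ) inferInstance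

theorem monomialVector_ne_zero {d : ℕ} {A : Set (Fin d → ℤ)} (hA : A.Nonempty) (z : AlgTorus d) :
    (fun m : A => laurentMonomial m z.1) ≠ 0 := by
  obtain ⟨m, hm⟩ := hA
  intro h
  exact Finset.prod_ne_zero_iff.2 (fun i _ => zpow_ne_zero (m i) (z.2 i)) (congrFun h ⟨m, hm⟩)

/-- The map `Φ(z) = [z^m : m ∈ A]` from the torus to projective space. -/
def toricMap {d : ℕ} {A : Set (Fin d → ℤ)} (hA : A.Nonempty) (z : AlgTorus d) : ℙ ℂ (A → ℂ) :=
  Projectivization.mk ℂ (fun m : A => laurentMonomial m z.1) (monomialVector_ne_zero hA z)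

/-- The toric variety `X_A`: the closure of the image of `Φ`. -/
def toricVariety {d : ℕ} {A : Set (Fin d → ℤ)} (hA : A.Nonempty) : Set (ℙ ℂ (A → ℂ)) :=
  closure (Set.range (toricMap hA))

/-- `X⁰(F)`: the points of `X_A` whose nonzero homogeneous coordinates are exactly those indexed by
the lattice points in `F`. -/
def openFaceAtInfinity {d : ℕ} {A : Set (Fin d → ℤ)} (hA : A.Nonempty) (F : Set (Fin d → ℝ)) :
    Set (ℙ ℂ (A → ℂ)) :=
  {p | p ∈ toricVariety hA ∧ ∀ m : A, p.rep m ≠ 0 ↔ latticeVec m.1 ∈ F}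

/-! ### Codimension -/

/-- The codimension in the affine space `ℂ^ι` of (the Zariski closure of) a set `S`: the height of
the ideal of the polynomials that vanish on `S`. It is `⊤` for the empty set. -/
def affineCodim {ι : Type*} (S : Set (ι → ℂ)) : ℕ∞ :=
  (MvPolynomial.vanishingIdeal ℂ S).height

end

/-! Since `m - v + κ v` lies in `κ P`, convergence of `Φ (z n)` to a point with nonzero coordinate
at `κ v` makes every `z n ^ (m - v)` converge, to `w m` say. Dividing `H = 0` and the log-gradient
by `z ^ v` and passing to the limit gives `∑ c m * w m = 0` and `∑ c m * w m * (m - v) = 0`. Let `B`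
be the support of `w` and `r` the rank of the lattice spanned by the `m - v`, `m ∈ B`. On `B`, `w`
is a monomial in `r` nonzero parameters `t`, and the limit equations put `c * w` in a linear space
of codimension `r + 1`. Such `c` therefore form a family of dimension at most `card - (r + 1) + r =
card - 1` and satisfy a nontrivial equation (`exists_aeval_eq_zero_of_singular_limit`). It depends
only on `(B, v)`, so the product over the finitely many pairs works for all `H`. -/

/-! ### Dimension count for monomial twists. -/

/-- The vectors which a monomial twist moves into a linear subspace `K` satisfy a nontrivial
polynomial equation as soon as `dim K` plus the number of twisting parameters is less than the
dimension of the ambient space. -/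
theorem exists_aeval_eq_zero_of_monomial_twist_mem {ι : Type*} [Fintype ι] {r : ℕ}
    (e : ι → Fin r → ℤ) (K : Submodule ℂ (ι → ℂ))
    (hK : Module.finrank ℂ K + r < Fintype.card ι) :
    ∃ f : MvPolynomial ι ℂ, f ≠ 0 ∧ ∀ (c : ι → ℂ) (t : Fin r → ℂ), (∀ i, t i ≠ 0) →
      (fun m => c m * ∏ i, t i ^ e m i) ∈ K → MvPolynomial.aeval c f = 0 := by
  obtain ⟨E, hE⟩ := (Set.finite_range fun p : ι × Fin r => e p.1 p.2).bddAbove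
  have hE' : ∀ m i, e m i ≤ E := fun m i => hE ⟨(m, i), rfl⟩
  let b := Module.finBasis ℂ K
  -- Parametrizes `c` by a point of `K` and `t`: undo the twist, then multiply by `∏ t ^ E` to clear
  -- negative exponents.
  let g : ι → MvPolynomial (Fin (Module.finrank ℂ K) ⊕ Fin r) ℂ := fun m =>
    (∑ j, MvPolynomial.C ((b j : ι → ℂ) m) * MvPolynomial.X (Sum.inl j)) *
      ∏ i, MvPolynomial.X (Sum.inr i) ^ (E - e m i).toNat
  -- There are more `g m` than the transcendence degree `dim K + r` allows.
  have hg : ¬ AlgebraicIndependent ℂ g := fun h => by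
    have := h.lift_cardinalMk_le_trdeg
    rw [MvPolynomial.trdeg_of_isDomain] at this
    simp only [Cardinal.mk_fintype, Fintype.card_sum, Fintype.card_fin, Cardinal.lift_natCast,
      Nat.cast_le] at this
    omega
  rw [algebraicIndependent_iff] at hg
  push Not at hg
  obtain ⟨f, hf, hf0⟩ := hg
  refine ⟨f, hf0, fun c t ht hc => ?_⟩
  -- The inverse factor cancels the `∏ t ^ E` built into `g`.
  let y : Fin (Module.finrank ℂ K) ⊕ Fin r → ℂ :=
    Sum.elim (fun j => b.repr ⟨_, hc⟩ j * (∏ i, t i ^ E)⁻¹) t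
  have hy : ∀ m, MvPolynomial.aeval y (g m) = c m := by
    intro m
    have hsum : ∑ j, (b j : ι → ℂ) m * b.repr ⟨_, hc⟩ j = c m * ∏ i, t i ^ e m i := by
      have := congrFun (congrArg Subtype.val (b.sum_repr ⟨_, hc⟩)) m
      rw [Submodule.coe_sum, Finset.sum_apply] at this
      simpa only [Submodule.coe_smul, Pi.smul_apply, smul_eq_mul, mul_comm] using this
    have hprod : ∏ i, t i ^ (E - e m i).toNat = (∏ i, t i ^ E) * (∏ i, t i ^ e m i)⁻¹ := by
      rw [← Finset.prod_inv_distrib, ← Finset.prod_mul_distrib]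
      refine Finset.prod_congr rfl fun i _ => ?_
      rw [← zpow_natCast, Int.toNat_of_nonneg (by linarith [hE' m i]), zpow_sub₀ (ht i),
        div_eq_mul_inv]
    have h1 : ∏ i, t i ^ E ≠ 0 := Finset.prod_ne_zero_iff.2 fun i _ => zpow_ne_zero _ (ht i)
    have h2 : ∏ i, t i ^ e m i ≠ 0 := Finset.prod_ne_zero_iff.2 fun i _ => zpow_ne_zero _ (ht i)
    simp only [g, map_mul, map_sum, map_prod, map_pow, MvPolynomial.aeval_C, MvPolynomial.aeval_X,
      y, Sum.elim_inl, Sum.elim_inr, Algebra.algebraMap_self, RingHom.id_apply, ← mul_assoc]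
    rw [← Finset.sum_mul, hsum, hprod]
    field_simp
  have := congrArg (MvPolynomial.aeval y) hf
  rw [← AlgHom.comp_apply, MvPolynomial.comp_aeval, map_zero] at this
  simpa [hy] using this

/-- Linearly independent integer vectors are linearly independent over `ℂ`. -/
theorem LinearIndependent.eq_zero_of_sum_mul_intCast {r d : ℕ} {b : Fin r → Fin d → ℤ}
    (hb : LinearIndependent ℤ b) {a : Fin r → ℂ} (h : ∀ k, ∑ i, a i * (b i k : ℂ) = 0) :
    a = 0 := by
  -- `N` is finitely generated and torsion-free, hence free; its coordinates split the complex
  -- relation into integral ones.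
  let N : Submodule ℤ ℂ := Submodule.span ℤ (Set.range a)
  have : Module.Finite ℤ N := Module.Finite.span_of_finite ℤ (Set.finite_range a)
  let u := Module.Free.chooseBasis ℤ N
  let a' : Fin r → N := fun i => ⟨a i, Submodule.subset_span ⟨i, rfl⟩⟩
  have h0 : ∀ k, ∑ i, b i k • a' i = 0 := fun k => by
    apply Subtype.ext
    simpa [a', mul_comm] using h k
  have h1 : ∀ l i, u.repr (a' i) l = 0 := fun l => by
    refine (Fintype.linearIndependent_iff.1 hb) (fun i => u.repr (a' i) l) ?_
    funext k
    have := congrArg (fun x => u.repr x l) (h0 k)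
    simpa [mul_comm] using this
  funext i
  have : a' i = 0 := u.repr.map_eq_zero_iff.1 (Finsupp.ext fun l => h1 l i)
  exact congrArg Subtype.val this

/-! ### Monomial limits and the singular equations. -/

theorem laurentMonomial_zero {d : ℕ} (z : Fin d → ℂ) : laurentMonomial 0 z = 1 := by
  simp [laurentMonomial]

theorem AlgTorus.laurentMonomial_ne_zero {d : ℕ} (z : AlgTorus d) (x : Fin d → ℤ) :
    laurentMonomial x z.1 ≠ 0 :=
  Finset.prod_ne_zero_iff.2 fun i _ => zpow_ne_zero _ (z.2 i)

theorem AlgTorus.laurentMonomial_add {d : ℕ} (z : AlgTorus d) (x y : Fin d → ℤ) :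
    laurentMonomial (x + y) z.1 = laurentMonomial x z.1 * laurentMonomial y z.1 := by
  simp only [laurentMonomial, Pi.add_apply, ← Finset.prod_mul_distrib]
  exact Finset.prod_congr rfl fun i _ => zpow_add₀ (z.2 i) _ _

theorem laurentMonomial_zsmul {d : ℕ} (z : Fin d → ℂ) (n : ℤ) (x : Fin d → ℤ) :
    laurentMonomial (n • x) z = laurentMonomial x z ^ n := by
  simp only [laurentMonomial, Pi.smul_apply, smul_eq_mul, ← Finset.prod_zpow]
  exact Finset.prod_congr rfl fun i _ => by rw [mul_comm, zpow_mul]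

theorem AlgTorus.laurentMonomial_sum {d r : ℕ} (z : AlgTorus d) (x : Fin r → Fin d → ℤ) :
    laurentMonomial (∑ i, x i) z.1 = ∏ i, laurentMonomial (x i) z.1 := by
  induction r with
  | zero => simp [laurentMonomial_zero]
  | succ n ih => rw [Fin.sum_univ_succ, Fin.prod_univ_succ, z.laurentMonomial_add, ih]

/-- If Laurent monomials have nonzero limits along a sequence in the torus, so has every monomial
whose exponent lies in the group generated by their exponents. -/
theorem exists_tendsto_laurentMonomial_of_mem_span {d : ℕ} {ι : Type*} {u : ι → Fin d → ℤ}
    {B : Set ι} {w : ι → ℂ} (hw : ∀ m ∈ B, w m ≠ 0) {z : ℕ → AlgTorus d}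
    (hz : ∀ m, Tendsto (fun n => laurentMonomial (u m) (z n).1) atTop (𝓝 (w m)))
    {x : Fin d → ℤ} (hx : x ∈ Submodule.span ℤ (u '' B)) :
    ∃ t : ℂ, t ≠ 0 ∧ Tendsto (fun n => laurentMonomial x (z n).1) atTop (𝓝 t) := by
  induction hx using Submodule.span_induction with
  | mem x hx =>
    obtain ⟨m, hm, rfl⟩ := hx
    exact ⟨w m, hw m hm, hz m⟩
  | zero => exact ⟨1, one_ne_zero, by simp [laurentMonomial_zero]⟩
  | add x y _ _ hx hy =>
    obtain ⟨s, hs, hs'⟩ := hx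
    obtain ⟨t, ht, ht'⟩ := hy
    refine ⟨s * t, mul_ne_zero hs ht, ?_⟩
    simpa only [AlgTorus.laurentMonomial_add] using hs'.mul ht'
  | smul n x _ hx =>
    obtain ⟨s, hs, hs'⟩ := hx
    refine ⟨s ^ n, zpow_ne_zero n hs, ?_⟩
    simpa only [laurentMonomial_zsmul] using hs'.zpow₀ n (Or.inl hs)

/-- The linear conditions `∑ a m = 0` and `∑ a m * e m i = 0` (sums over `B`) on a vector `a`. -/
noncomputable def momentMap {ι : Type*} [Fintype ι] (B : Finset ι) {r : ℕ}
    (e : ι → Fin r → ℤ) : (ι → ℂ) →ₗ[ℂ] ℂ × (Fin r → ℂ) where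
  toFun a := (∑ m ∈ B, a m, fun i => ∑ m ∈ B, a m * e m i)
  map_add' a b := by
    ext <;> simp [Finset.sum_add_distrib, add_mul]
  map_smul' s a := by
    ext <;> simp [Finset.mul_sum, mul_assoc]

theorem momentMap_single {ι : Type*} [Fintype ι] [DecidableEq ι] {B : Finset ι} {r : ℕ}
    (e : ι → Fin r → ℤ) {m : ι} (hm : m ∈ B) :
    momentMap B e (Pi.single m 1) = (1, fun i => (e m i : ℂ)) := by
  ext <;> simp [momentMap, Pi.single_apply, hm]

/-- The coefficient vectors which are singular at a limit point with nonzero coordinates indexed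
by `B` satisfy a nontrivial polynomial equation. -/
theorem exists_aeval_eq_zero_of_singular_limit {d : ℕ} {ι : Type*} [Fintype ι]
    (u : ι → Fin d → ℤ) (B : Finset ι) {v : ι} (hvB : v ∈ B) (huv : u v = 0) :
    ∃ f : MvPolynomial ι ℂ, f ≠ 0 ∧ ∀ (c w : ι → ℂ) (z : ℕ → AlgTorus d),
      (∀ m, m ∈ B ↔ w m ≠ 0) →
      (∀ m, Tendsto (fun n => laurentMonomial (u m) (z n).1) atTop (𝓝 (w m))) →
      ∑ m, c m * w m = 0 → (∀ k, ∑ m, c m * w m * (u m k : ℂ) = 0) →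
      MvPolynomial.aeval c f = 0 := by
  classical
  let N : Submodule ℤ (Fin d → ℤ) := Submodule.span ℤ (u '' B)
  let b := Module.finBasis ℤ N
  have hu : ∀ m ∈ B, u m ∈ N := fun m hm => Submodule.subset_span ⟨m, hm, rfl⟩
  -- The value off `B` is immaterial: `momentMap` sums over `B` only.
  let e : ι → Fin (Module.finrank ℤ N) → ℤ := fun m =>
    if hm : m ∈ B then b.repr ⟨u m, hu m hm⟩ else 0
  have he : ∀ m (hm : m ∈ B), e m = b.repr ⟨u m, hu m hm⟩ := fun m hm => by simp [e, hm]
  have hue : ∀ m ∈ B, u m = ∑ i, e m i • (b i : Fin d → ℤ) := fun m hm => by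
    have := congrArg Subtype.val (b.sum_repr ⟨u m, hu m hm⟩)
    rw [Submodule.coe_sum] at this
    simpa only [he m hm, Submodule.coe_smul] using this.symm
  have hev : e v = 0 := by
    have : (⟨u v, hu v hvB⟩ : N) = 0 := Subtype.ext huv
    rw [he v hvB, this, map_zero]; rfl
  -- `v` contributes `(1, 0)`, and the differences with `v` contribute `(0, e m)`, which generate `ℤ
  -- ^ r`.
  have hsurj : LinearMap.range (momentMap B e) = ⊤ := by
    have h1 : ((1, 0) : ℂ × (Fin (Module.finrank ℤ N) → ℂ)) ∈ LinearMap.range (momentMap B e) :=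
      ⟨Pi.single v 1, by rw [momentMap_single e hvB, hev]; ext <;> simp⟩
    have h2 : ∀ x (hx : x ∈ N), ((0, fun i => (b.repr ⟨x, hx⟩ i : ℂ)) :
        ℂ × (Fin (Module.finrank ℤ N) → ℂ)) ∈ LinearMap.range (momentMap B e) := by
      intro x hx
      induction hx using Submodule.span_induction with
      | mem x hx =>
        obtain ⟨m, hm, rfl⟩ := hx
        refine ⟨Pi.single m 1 - Pi.single v 1, ?_⟩
        rw [map_sub, momentMap_single e hm, momentMap_single e hvB, hev, he m hm]
        ext <;> simp
      | zero =>
        convert Submodule.zero_mem _ using 1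
        have : b.repr ⟨0, N.zero_mem⟩ = 0 := b.repr.map_zero
        rw [this]
        ext <;> simp
      | add x y hx hy hx' hy' =>
        convert Submodule.add_mem _ hx' hy' using 1
        have : b.repr ⟨x + y, N.add_mem hx hy⟩ = b.repr ⟨x, hx⟩ + b.repr ⟨y, hy⟩ :=
          b.repr.map_add ⟨x, hx⟩ ⟨y, hy⟩
        rw [this]
        ext <;> simp
      | smul n x hx hx' =>
        convert Submodule.smul_mem _ (n : ℂ) hx' using 1
        have : b.repr ⟨n • x, N.smul_mem n hx⟩ = n • b.repr ⟨x, hx⟩ :=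
          b.repr.map_smul n ⟨x, hx⟩
        rw [this]
        ext <;> simp
    refine eq_top_iff.2 fun y _ => ?_
    have hy : y = y.1 • ((1, 0) : ℂ × (Fin (Module.finrank ℤ N) → ℂ)) +
        ∑ i, y.2 i • ((0, fun k => (b.repr ⟨(b i : Fin d → ℤ), (b i).2⟩ k : ℂ)) :
          ℂ × (Fin (Module.finrank ℤ N) → ℂ)) := by
      ext k
      · simp [Prod.fst_sum]
      · simp [Prod.snd_sum, Finset.sum_apply, Finsupp.single_apply]
    rw [hy]
    exact Submodule.add_mem _ (Submodule.smul_mem _ _ h1)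
      (Submodule.sum_mem _ fun i _ => Submodule.smul_mem _ _ (h2 _ _))
  have hK : Module.finrank ℂ (LinearMap.ker (momentMap B e)) + Module.finrank ℤ N <
      Fintype.card ι := by
    have := LinearMap.finrank_range_add_finrank_ker (momentMap B e)
    rw [hsurj, finrank_top] at this
    simp only [Module.finrank_prod, Module.finrank_self, Module.finrank_fintype_fun_eq_card,
      Fintype.card_fin] at this
    omega
  obtain ⟨f, hf, hfK⟩ := exists_aeval_eq_zero_of_monomial_twist_mem e _ hK
  refine ⟨f, hf, fun c w z hB hz hsum hgrad => ?_⟩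
  -- `t i` is the limit of the `i`-th basis monomial.
  choose t ht htz using fun i => exists_tendsto_laurentMonomial_of_mem_span
    (B := (B : Set ι)) (fun m hm => (hB m).1 hm) hz (b i).2
  have hwt : ∀ m ∈ B, w m = ∏ i, t i ^ e m i := fun m hm => by
    refine tendsto_nhds_unique (hz m) ?_
    simp only [hue m hm, AlgTorus.laurentMonomial_sum, laurentMonomial_zsmul]
    exact tendsto_finsetProd _ fun i _ => (htz i).zpow₀ _ (Or.inl (ht i))
  have hsupp : ∀ g : ι → ℂ, ∑ m ∈ B, c m * w m * g m = ∑ m, c m * w m * g m := fun g =>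
    Finset.sum_subset (Finset.subset_univ B) fun m _ hm => by
      rw [not_not.1 (fun h => hm ((hB m).2 h)), mul_zero, zero_mul]
  have hzero : (fun i => ∑ m ∈ B, c m * w m * (e m i : ℂ)) = 0 := by
    refine LinearIndependent.eq_zero_of_sum_mul_intCast
      (b := fun i => (b i : Fin d → ℤ)) (b.linearIndependent.map' N.subtype N.ker_subtype) ?_
    intro k
    rw [← hgrad k, ← hsupp]
    simp only [Finset.sum_mul]
    rw [Finset.sum_comm]
    refine Finset.sum_congr rfl fun m hm => ?_
    rw [hue m hm]
    simp [Finset.mul_sum, mul_assoc]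
  refine hfK c t ht ?_
  rw [LinearMap.mem_ker]
  ext i
  · have := hsupp 1
    simp only [Pi.one_apply, mul_one, hsum] at this
    simp only [momentMap, LinearMap.coe_mk, AddHom.coe_mk, Prod.fst_zero]
    rw [← this]
    exact Finset.sum_congr rfl fun m hm => by rw [hwt m hm]
  · have := congrFun hzero i
    simp only [momentMap, LinearMap.coe_mk, AddHom.coe_mk, Prod.snd_zero]
    rw [← this]
    exact Finset.sum_congr rfl fun m hm => by rw [hwt m hm]

/-! ### From projective limits to coefficient equations. -/

/-- Convergence in projective space implies convergence of the ratios of homogeneous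
coordinates. -/
theorem Projectivization.tendsto_div_of_tendsto_mk {ι α : Type*} {l : Filter α} {x : α → ι → ℂ}
    (hx : ∀ n, x n ≠ 0) {p : ℙ ℂ (ι → ℂ)}
    (h : Tendsto (fun n => Projectivization.mk ℂ (x n) (hx n)) l (𝓝 p)) {j : ι} (hj : p.rep j ≠ 0)
    (i : ι) : Tendsto (fun n => x n i / x n j) l (𝓝 (p.rep i / p.rep j)) := by
  have hrep : ∀ (y : ι → ℂ) (hy : y ≠ 0), ∃ a : ℂ, a ≠ 0 ∧
      ∀ k, (Projectivization.mk ℂ y hy).rep k = a * y k := fun y hy => by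
    obtain ⟨a, ha⟩ := Projectivization.exists_smul_eq_mk_rep ℂ y hy
    exact ⟨a, a.ne_zero, fun k => by rw [← ha]; rfl⟩
  have hdiv : ∀ (y : ι → ℂ) (hy : y ≠ 0), (Projectivization.mk ℂ y hy).rep i /
      (Projectivization.mk ℂ y hy).rep j = y i / y j := fun y hy => by
    obtain ⟨a, ha, h⟩ := hrep y hy
    rw [h, h, mul_div_mul_left _ _ ha]
  rw [tendsto_nhds]
  intro V hV hpV
  let U : Set (ℙ ℂ (ι → ℂ)) := {q | q.rep j ≠ 0 ∧ q.rep i / q.rep j ∈ V}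
  -- Ratios do not depend on the representative, so openness can be tested on nonzero vectors.
  have hU : IsOpen U := by
    rw [isOpen_coinduced]
    have : Projectivization.mk' ℂ ⁻¹' U =
        {y : {y : ι → ℂ // y ≠ 0} | y.1 j ≠ 0} ∩ (fun y => y.1 i / y.1 j) ⁻¹' V := by
      ext ⟨y, hy⟩
      obtain ⟨a, ha, h⟩ := hrep y hy
      simp only [U, Set.mem_preimage, Projectivization.mk'_eq_mk, Set.mem_ofPred_eq,
        Set.mem_inter_iff, hdiv]
      rw [h, mul_ne_zero_iff, and_iff_right ha]
    rw [this]
    have hc : ∀ k : ι, Continuous fun y : {y : ι → ℂ // y ≠ 0} => y.1 k := fun k =>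
      (continuous_apply k).comp continuous_subtype_val
    refine ContinuousOn.isOpen_inter_preimage ?_ ?_ hV
    · exact (hc i).continuousOn.div (hc j).continuousOn fun y hy => hy
    · exact isOpen_ne_fun (hc j) continuous_const
  filter_upwards [h (hU.mem_nhds (show p ∈ U from ⟨hj, hpV⟩))] with n hn
  have := hn.2
  rwa [hdiv] at this

theorem finite_latticePoints {d : ℕ} {P : Set (Fin d → ℝ)} (hP : Bornology.IsBounded P) :
    (latticePoints P).Finite := by
  obtain ⟨R, hR⟩ := hP.exists_norm_le
  refine (Set.finite_Icc (fun _ : Fin d => -⌈R⌉) (fun _ => ⌈R⌉)).subset fun m hm => ?_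
  have h : ∀ i, |(m i : ℝ)| ≤ (⌈R⌉ : ℝ) := fun i =>
    ((norm_le_pi_norm (latticeVec m) i).trans (hR _ hm)).trans (Int.le_ceil R)
  exact ⟨fun i => by exact_mod_cast (abs_le.1 (h i)).1,
    fun i => by exact_mod_cast (abs_le.1 (h i)).2⟩

theorem IsLatticePolytope.isBounded {d : ℕ} {P : Set (Fin d → ℝ)} (hP : IsLatticePolytope P) :
    Bornology.IsBounded P := by
  obtain ⟨S, -, rfl⟩ := hP
  exact isBounded_convexHull.2 (S.finite_toSet.image _).isBounded

theorem IsLatticePolytope.convex {d : ℕ} {P : Set (Fin d → ℝ)} (hP : IsLatticePolytope P) :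
    Convex ℝ P := by
  obtain ⟨S, -, rfl⟩ := hP
  exact convex_convexHull ℝ _

theorem hasDerivAt_laurentMonomial_update {d : ℕ} (m : Fin d → ℤ) (z : AlgTorus d) (i : Fin d) :
    HasDerivAt (fun t => laurentMonomial m (Function.update z.1 i t))
      ((m i : ℂ) * laurentMonomial m z.1 / z.1 i) (z.1 i) := by
  have h : ∀ t, laurentMonomial m (Function.update z.1 i t) =
      t ^ m i * ∏ j ∈ Finset.univ.erase i, z.1 j ^ m j := fun t => by
    rw [laurentMonomial, ← Finset.mul_prod_erase _ _ (Finset.mem_univ i), Function.update_self]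
    congr 1
    exact Finset.prod_congr rfl fun j hj => by
      rw [Function.update_of_ne (Finset.ne_of_mem_erase hj)]
  have h' := h (z.1 i)
  rw [Function.update_eq_self] at h'
  rw [funext h, h']
  refine ((hasDerivAt_zpow (m i) (z.1 i) (Or.inl (z.2 i))).mul_const
    (∏ j ∈ Finset.univ.erase i, z.1 j ^ m j)).congr_deriv ?_
  rw [zpow_sub_one₀ (z.2 i)]
  ring

theorem logGradient_apply {d : ℕ} (H : MvLaurent d) (z : AlgTorus d) (i : Fin d) :
    logGradient H z.1 i = H.coeff.sum fun m a => a * ((m i : ℂ) * laurentMonomial m z.1) := by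
  have h : HasDerivAt (fun t => H.value (Function.update z.1 i t))
      (∑ m ∈ H.coeff.support, H.coeff m * ((m i : ℂ) * laurentMonomial m z.1 / z.1 i)) (z.1 i) :=
    HasDerivAt.fun_sum fun m _ => (hasDerivAt_laurentMonomial_update m z i).const_mul _
  rw [logGradient, h.deriv, Finsupp.sum, Finset.mul_sum]
  refine Finset.sum_congr rfl fun m _ => ?_
  field_simp [z.2 i]

theorem coeff_support_subset_latticePoints {d : ℕ} (H : MvLaurent d) :
    (H.coeff.support : Set (Fin d → ℤ)) ⊆ latticePoints (newtonPolytope H) := fun m hm =>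
  subset_convexHull ℝ _ ⟨m, hm, rfl⟩

theorem MvLaurent.sum_coeff_eq {d : ℕ} (H : MvLaurent d) {P : Set (Fin d → ℝ)}
    [Fintype (latticePoints P)] (hH : newtonPolytope H = P) (g : (Fin d → ℤ) → ℂ) :
    (H.coeff.sum fun m a => a * g m) = ∑ m : latticePoints P, coeffVector P H m * g m := by
  classical
  rw [Finsupp.sum_of_support_subset (s := (latticePoints P).toFinset)]
  · rw [← Finset.sum_coe_sort (latticePoints P).toFinset]
    exact Fintype.sum_equiv (Equiv.subtypeEquivRight fun m => Set.mem_toFinset) _ _ fun _ => rfl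
  · rw [← Finset.coe_subset, Set.coe_toFinset, ← hH]
    exact coeff_support_subset_latticePoints H
  · simp

/-- The point is `κ` times the convex combination `(1/κ) m + ((κ - 1)/κ) v`. -/
theorem smul_sub_mem_latticePoints {d : ℕ} {P : Set (Fin d → ℝ)} (hP : Convex ℝ P) {κ : ℕ}
    (hκ : 0 < κ) {m v : Fin d → ℤ} (hm : m ∈ latticePoints P) (hv : v ∈ latticePoints P) :
    (m - v) + (κ : ℤ) • v ∈ latticePoints ((κ : ℝ) • P) := by
  have hκ' : (0 : ℝ) < κ := by exact_mod_cast hκ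
  have hκ1 : (1 : ℝ) ≤ κ := by exact_mod_cast hκ
  refine ⟨(1 / κ : ℝ) • latticeVec m + ((κ - 1) / κ : ℝ) • latticeVec v,
    hP hm hv (by positivity) (div_nonneg (by linarith) hκ'.le) (by field_simp; ring), ?_⟩
  ext i
  simp [latticeVec]
  field_simp
  ring

theorem affineCodim_pos_of_aeval_eq_zero {ι : Type*} {S : Set (ι → ℂ)} {f : MvPolynomial ι ℂ}
    (hf : f ≠ 0) (h : ∀ c ∈ S, MvPolynomial.aeval c f = 0) : 0 < affineCodim S := by
  rw [affineCodim, pos_iff_ne_zero, Ne, Ideal.height_eq_zero_iff_eq_bot]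
  intro h0
  have : f ∈ MvPolynomial.vanishingIdeal ℂ S := MvPolynomial.mem_vanishingIdeal_iff.2 h
  rw [h0] at this
  exact hf this

theorem theorem3p3 (d : ℕ) (P : Set (Fin d → ℝ)) (hP : IsLatticePolytope P)
    (κ : ℕ) (hκ : 0 < κ) (hQ : IsNormalPolytope ((κ : ℝ) • P)) :
    0 < affineCodim {c : latticePoints P → ℂ |
      ∃ H : MvLaurent d, newtonPolytope H = P ∧ coeffVector P H = c ∧
        ∃ F : Set (Fin d → ℝ), IsPolytopeFace ((κ : ℝ) • P) F ∧
        ∃ p ∈ openFaceAtInfinity (hP.latticePoints_smul_nonempty κ) F,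
        ∃ v : Fin d → ℤ, latticeVec v ∈ Set.extremePoints ℝ ((κ : ℝ)⁻¹ • F) ∧
        ∃ z : ℕ → AlgTorus d, (∀ n, z n ∈ torusZeroSet H) ∧
          Tendsto (fun n => toricMap (hP.latticePoints_smul_nonempty κ) (z n)) atTop (𝓝 p) ∧
          Tendsto (fun n => laurentMonomial (-v) (z n).1 • logGradient H (z n).1)
            atTop (𝓝 0)} := by
  classical
  have : Finite (latticePoints P) := (finite_latticePoints hP.isBounded).to_subtype
  have := Fintype.ofFinite (latticePoints P)
  have hκ' : (κ : ℝ) ≠ 0 := by exact_mod_cast hκ.ne'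
  choose f hf hfz using fun q : {q : Finset (latticePoints P) × latticePoints P // q.2 ∈ q.1} =>
    exists_aeval_eq_zero_of_singular_limit
      (fun m : latticePoints P => (m : Fin d → ℤ) - (q.1.2 : Fin d → ℤ)) q.1.1 q.2 (sub_self _)
  refine affineCodim_pos_of_aeval_eq_zero (f := ∏ q, f q)
    (Finset.prod_ne_zero_iff.2 fun q _ => hf q) ?_
  rintro c ⟨H, hH, rfl, F, hF, p, hp, v, hv, z, hz, hzp, hgrad⟩
  obtain ⟨x, hxF, hx⟩ := hv.1
  have hx' : x = latticeVec ((κ : ℤ) • v) := by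
    have := congrArg (fun y => (κ : ℝ) • y) hx
    simp only [smul_smul, mul_inv_cancel₀ hκ', one_smul] at this
    rw [this]
    ext i
    simp [latticeVec]
  have hκvF : latticeVec ((κ : ℤ) • v) ∈ F := hx' ▸ hxF
  have hκv : (κ : ℤ) • v ∈ latticePoints ((κ : ℝ) • P) := hF.2.subset hκvF
  have hvP : v ∈ latticePoints P := by
    obtain ⟨y, hy, hyv⟩ := hF.2.subset hxF
    have : latticeVec v = y := by
      rw [← hx, ← hyv]
      simp [smul_smul, hκ']
    exact show latticeVec v ∈ P from this ▸ hy
  have hj : p.rep ⟨_, hκv⟩ ≠ 0 := (hp.2 ⟨_, hκv⟩).2 hκvF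
  let w : latticePoints P → ℂ := fun m =>
    p.rep ⟨_, smul_sub_mem_latticePoints hP.convex hκ m.2 hvP⟩ / p.rep ⟨_, hκv⟩
  have hw : ∀ m : latticePoints P,
      Tendsto (fun n => laurentMonomial ((m : Fin d → ℤ) - v) (z n).1) atTop (𝓝 (w m)) := by
    intro m
    refine (Projectivization.tendsto_div_of_tendsto_mk _ hzp hj
      ⟨_, smul_sub_mem_latticePoints hP.convex hκ m.2 hvP⟩).congr fun n => ?_
    rw [(z n).laurentMonomial_add, mul_div_cancel_right₀ _ ((z n).laurentMonomial_ne_zero _)]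
  have hmul : ∀ n (m : Fin d → ℤ), laurentMonomial (-v) (z n).1 * laurentMonomial m (z n).1 =
      laurentMonomial (m - v) (z n).1 := fun n m => by
    rw [← (z n).laurentMonomial_add, neg_add_eq_sub]
  -- This puts `v` in the support of `w`, so the pair (support, `v`) is among the factors.
  have hwv : w ⟨v, hvP⟩ = 1 := by
    refine tendsto_nhds_unique (hw _) ?_
    simp [laurentMonomial_zero]
  have hsum : ∑ m, coeffVector P H m * w m = 0 := by
    refine tendsto_nhds_unique
      (tendsto_finsetSum Finset.univ fun m _ => (hw m).const_mul (coeffVector P H m)) ?_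
    refine tendsto_const_nhds.congr fun n => ?_
    have : H.value (z n).1 = 0 := hz n
    rw [MvLaurent.value, H.sum_coeff_eq hH (fun m => laurentMonomial m (z n).1)] at this
    have h := congrArg (laurentMonomial (-v) (z n).1 * ·) this
    simp only [mul_zero, Finset.mul_sum] at h
    exact h.symm.trans (Finset.sum_congr rfl fun m _ => by rw [← hmul]; ring)
  have hsum' : ∀ k, ∑ m : latticePoints P,
      coeffVector P H m * w m * ((m : Fin d → ℤ) k : ℂ) = 0 := by
    intro k
    refine tendsto_nhds_unique (tendsto_finsetSum Finset.univ fun m _ =>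
      ((hw m).const_mul (coeffVector P H m)).mul_const _) ?_
    refine ((tendsto_pi_nhds.1 hgrad) k).congr fun n => ?_
    rw [Pi.smul_apply, smul_eq_mul, logGradient_apply,
      H.sum_coeff_eq hH (fun m => (m k : ℂ) * laurentMonomial m (z n).1), Finset.mul_sum]
    exact Finset.sum_congr rfl fun m _ => by rw [← hmul]; ring
  rw [map_prod]
  refine Finset.prod_eq_zero
    (i := ⟨(Finset.univ.filter fun m => w m ≠ 0, ⟨v, hvP⟩), by simp [hwv]⟩) (Finset.mem_univ _) ?_
  refine hfz _ _ w z (fun m => by simp) hw hsum fun k => ?_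
  -- `∑ c m * w m = 0` allows the exponents to be shifted from `m` to `m - v`.
  have : ∑ m : latticePoints P, coeffVector P H m * w m * (v k : ℂ) = 0 := by
    rw [← Finset.sum_mul, hsum, zero_mul]
  simpa [mul_sub, Finset.sum_sub_distrib, this] using hsum' k
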